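/- Let $d\ge 1$ and let $D\subset\mathbb{R}^d$ be a bounded open set with $H^2$ elliptic regularity for the homogeneous Dirichlet problem: there is $C_D$ such that for every $f\in L^2(D)$ every weak solution $q\in H^1_0(D)$ of $\Delta q=f$ satisfies $q\in H^2(D)$ and $\|q\|_{H^2}\le C_D\|f\|_{L^2}$. Write $(\cdot,\cdot)$ for the inner products of $L^2(D)$ and of $L^2(D)^d$. For every $K>0$ there is a constant $C>0$, depending only on $D$ and $K$, such that the following holds for every $h>0$ and every pair of finite-dimensional spaces $V_h\subset H^1(D)^d$, $Q_h\subset L^2(D)$ with the following properties. 1. There is a linear operator $\Pi_h:H^1(D)^d\to V_h$ (Fortin operator) such that for all $v\in H^1(D)^d$: $(\nabla\cdot(v-\Pi_hv),q_h)=0$ for all $q_h\in Q_h$, $\|v-\Pi_hv\|_{L^2}\le Kh\|v\|_{H^1}$, $\|v-\Pi_hv\|_{H^1}\le K\|v\|_{H^1}$, and $\|\Pi_hv\|_{H^1}\le K\|v\|_{H^1}$. 2. For $m=1,2$: $\inf_{q_h\in Q_h}\|q-q_h\|_{L^2}\le Kh^m\|q\|_{H^m}$ for all $q\in H^m(D)$,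 and $\inf_{q_h\in Q_h\cap H^1_0(D)}\|q-q_h\|_{L^2}\le Kh^m\|q\|_{H^m}$ for all $q\in H^m(D)\cap H^1_0(D)$. 3. $\|v_h\|_{H^1}\le Kh^{-1}\|v_h\|_{L^2}$ for all $v_h\in V_h$. 4. $\|q_h\|_{L^2}\le K\sup_{0\ne v_h\in V_h}\frac{(q_h,\nabla\cdot v_h)}{\|v_h\|_{H^1}}$ for all $q_h\in Q_h$ (the supremum being $0$ if $V_h=0$). Let $X_h=\{v_h\in V_h:(\nabla\cdot v_h,q_h)=0\ \ \forall q_h\in Q_h\}$, let $X_h^\perp$ be the $L^2$-orthogonal complement of $X_h$ in $V_h$, and let $P_{X_h}:L^2(D)^d\to X_h$ be the $L^2$-orthogonal projection. Then every $v_h\in V_h$ has a unique decomposition $v_h=w_h+z_h$ with $w_h\in X_h$, $z_h\in X_h^\perp$; it satisfies $$\|w_h\|_{H^1}+\|z_h\|_{H^1}\le C\|v_h\|_{H^1};$$ and $$\|P_{X_h}v\|_{H^1}\le C\|v\|_{H^1}\qquad\text{for all } v\in H^1(D)^d .$$ -/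

import Mathlib

open MeasureTheory TopologicalSpace
open scoped ContDiff InnerProductSpace

noncomputable section

namespace StokesFEM

/-- The Euclidean space `ℝ^d`. -/
abbrev E (d : ℕ) : Type := EuclideanSpace ℝ (Fin d)

variable {d : ℕ}

/-- The real space `L²(D)` with respect to Lebesgue measure. -/
abbrev L2 (D : Opens (E d)) : Type := Lp ℝ 2 (volume.restrict (D : Set (E d)))

/-- The space `L²(D)^d`, with the inner product `(v, w) = ∑ i, (v i, w i)`. -/
abbrev L2Vec (D : Opens (E d)) : Type := PiLp 2 (fun _ : Fin d => L2 D)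

/-- `φ ∈ C_c^∞(D)`. -/
structure IsTest (D : Opens (E d)) (φ : E d → ℝ) : Prop where
  smooth : ContDiff ℝ ∞ φ
  compact : HasCompactSupport φ
  support : tsupport φ ⊆ D

/-- The classical partial derivative `∂φ/∂x_i`. -/
def partialDeriv (i : Fin d) (φ : E d → ℝ) (x : E d) : ℝ :=
  fderiv ℝ φ x (EuclideanSpace.single i 1)

/-- `g` is the weak `i`-th partial derivative of `u` in `D`:
`∫_D u ∂_i φ = - ∫_D g φ` for all `φ ∈ C_c^∞(D)`. -/
def HasWeakDeriv {D : Opens (E d)} (i : Fin d) (u g : L2 D) : Prop :=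
  ∀ φ : E d → ℝ, IsTest D φ →
    ∫ x in (D : Set (E d)), u x * partialDeriv i φ x
      = - ∫ x in (D : Set (E d)), g x * φ x

theorem IsTest.memLp {D : Opens (E d)} {φ : E d → ℝ} (h : IsTest D φ) :
    MemLp φ 2 (volume.restrict (D : Set (E d))) :=
  h.smooth.continuous.memLp_of_hasCompactSupport h.compact

theorem IsTest.memLp_partialDeriv {D : Opens (E d)} {φ : E d → ℝ} (h : IsTest D φ)
    (i : Fin d) : MemLp (partialDeriv i φ) 2 (volume.restrict (D : Set (E d))) := by
  refine Continuous.memLp_of_hasCompactSupport ?_ ?_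
  · exact (h.smooth.continuous_fderiv (by simp)).clm_apply continuous_const
  · exact h.compact.fderiv_apply (𝕜 := ℝ) _

theorem HasWeakDeriv.add {D : Opens (E d)} {i : Fin d} {u₁ u₂ g₁ g₂ : L2 D}
    (h₁ : HasWeakDeriv i u₁ g₁) (h₂ : HasWeakDeriv i u₂ g₂) :
    HasWeakDeriv i (u₁ + u₂) (g₁ + g₂) := by
  intro φ hφ
  have hp := hφ.memLp_partialDeriv i
  have hm := hφ.memLp
  have e₁ : ∫ x in (D : Set (E d)), (u₁ + u₂ : L2 D) x * partialDeriv i φ x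
      = ∫ x in (D : Set (E d)), (u₁ x * partialDeriv i φ x + u₂ x * partialDeriv i φ x) := by
    refine integral_congr_ae ?_
    filter_upwards [Lp.coeFn_add u₁ u₂] with x hx
    rw [hx, Pi.add_apply, add_mul]
  have e₂ : ∫ x in (D : Set (E d)), (g₁ + g₂ : L2 D) x * φ x
      = ∫ x in (D : Set (E d)), (g₁ x * φ x + g₂ x * φ x) := by
    refine integral_congr_ae ?_
    filter_upwards [Lp.coeFn_add g₁ g₂] with x hx
    rw [hx, Pi.add_apply, add_mul]
  have s₁ : ∫ x in (D : Set (E d)), (u₁ x * partialDeriv i φ x + u₂ x * partialDeriv i φ x)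
      = (∫ x in (D : Set (E d)), u₁ x * partialDeriv i φ x)
        + ∫ x in (D : Set (E d)), u₂ x * partialDeriv i φ x :=
    integral_add ((Lp.memLp u₁).integrable_mul hp) ((Lp.memLp u₂).integrable_mul hp)
  have s₂ : ∫ x in (D : Set (E d)), (g₁ x * φ x + g₂ x * φ x)
      = (∫ x in (D : Set (E d)), g₁ x * φ x) + ∫ x in (D : Set (E d)), g₂ x * φ x :=
    integral_add ((Lp.memLp g₁).integrable_mul hm) ((Lp.memLp g₂).integrable_mul hm)
  rw [e₁, e₂, s₁, s₂, h₁ φ hφ, h₂ φ hφ, neg_add]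

theorem HasWeakDeriv.smul {D : Opens (E d)} {i : Fin d} {u g : L2 D} (c : ℝ)
    (h : HasWeakDeriv i u g) : HasWeakDeriv i (c • u) (c • g) := by
  intro φ hφ
  have e₁ : ∫ x in (D : Set (E d)), (c • u : L2 D) x * partialDeriv i φ x
      = ∫ x in (D : Set (E d)), c * (u x * partialDeriv i φ x) := by
    refine integral_congr_ae ?_
    filter_upwards [Lp.coeFn_smul c u] with x hx
    rw [hx, Pi.smul_apply, smul_eq_mul, mul_assoc]
  have e₂ : ∫ x in (D : Set (E d)), (c • g : L2 D) x * φ x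
      = ∫ x in (D : Set (E d)), c * (g x * φ x) := by
    refine integral_congr_ae ?_
    filter_upwards [Lp.coeFn_smul c g] with x hx
    rw [hx, Pi.smul_apply, smul_eq_mul, mul_assoc]
  rw [e₁, e₂, integral_const_mul, integral_const_mul, h φ hφ, mul_neg]

theorem HasWeakDeriv.zero {D : Opens (E d)} (i : Fin d) : HasWeakDeriv i (0 : L2 D) 0 := by
  intro φ _
  have e : ∀ ψ : E d → ℝ, ∫ x in (D : Set (E d)), (0 : L2 D) x * ψ x = 0 := by
    intro ψ
    rw [← integral_zero (E d) ℝ (μ := volume.restrict (D : Set (E d)))]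
    refine integral_congr_ae ?_
    filter_upwards [Lp.coeFn_zero ℝ 2 (volume.restrict (D : Set (E d)))] with x hx
    rw [hx, Pi.zero_apply, zero_mul]
  rw [e, e, neg_zero]

/-- Weak derivatives are unique. -/
theorem HasWeakDeriv.unique {D : Opens (E d)} {i : Fin d} {u g₁ g₂ : L2 D}
    (h₁ : HasWeakDeriv i u g₁) (h₂ : HasWeakDeriv i u g₂) : g₁ = g₂ := by
  have h := h₁.add (h₂.smul (-1))
  have hz : u + (-1 : ℝ) • u = 0 := by rw [neg_one_smul, add_neg_cancel]
  rw [hz] at h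
  have hg : g₁ + (-1 : ℝ) • g₂ = 0 := by
    set g := g₁ + (-1 : ℝ) • g₂ with hgdef
    rw [Lp.eq_zero_iff_ae_eq_zero]
    have hloc : LocallyIntegrableOn g (D : Set (E d)) volume := by
      refine locallyIntegrableOn_of_locallyIntegrable_restrict ?_
      exact (Lp.memLp g).locallyIntegrable (by norm_num)
    have key := D.isOpen.ae_eq_zero_of_integral_contDiff_smul_eq_zero hloc (by
      intro φ hs hc ht
      have h0 := (HasWeakDeriv.zero (D := D) i) φ ⟨hs, hc, ht⟩
      have h1 := h φ ⟨hs, hc, ht⟩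
      have e0 : ∫ x in (D : Set (E d)), (0 : L2 D) x * φ x = 0 := by
        rw [← integral_zero (E d) ℝ (μ := volume.restrict (D : Set (E d)))]
        refine integral_congr_ae ?_
        filter_upwards [Lp.coeFn_zero ℝ 2 (volume.restrict (D : Set (E d)))] with x hx
        rw [hx, Pi.zero_apply, zero_mul]
      rw [h0, e0, neg_zero] at h1
      have h2 : ∫ x in (D : Set (E d)), g x * φ x = 0 := by linarith
      rw [← h2, ← setIntegral_eq_integral_of_forall_compl_eq_zero (s := (D : Set (E d)))]
      · simp only [smul_eq_mul, mul_comm]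
      · intro x hx
        have : φ x = 0 := by
          by_contra hne
          exact hx (ht (subset_tsupport φ hne))
        rw [this, zero_smul])
    exact (ae_restrict_iff' D.isOpen.measurableSet).2 key
  rw [neg_one_smul] at hg
  exact add_neg_eq_zero.1 hg

open Classical in
/-- The weak partial derivative `∂_i u ∈ L²(D)`, where it exists (and `0` otherwise). -/
def weakDeriv {D : Opens (E d)} (i : Fin d) (u : L2 D) : L2 D :=
  if h : ∃ g : L2 D, HasWeakDeriv i u g then h.choose else 0

theorem HasWeakDeriv.weakDeriv_eq {D : Opens (E d)} {i : Fin d} {u g : L2 D}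
    (h : HasWeakDeriv i u g) : weakDeriv i u = g := by
  have hex : ∃ g : L2 D, HasWeakDeriv i u g := ⟨g, h⟩
  rw [weakDeriv, dif_pos hex]
  exact hex.choose_spec.unique h

/-- The Sobolev space `H¹(D)`, as a subspace of `L²(D)`. -/
def H1 (D : Opens (E d)) : Submodule ℝ (L2 D) where
  carrier := {u | ∀ i : Fin d, ∃ g : L2 D, HasWeakDeriv i u g}
  add_mem' := fun ha hb i =>
    ⟨_, (ha i).choose_spec.add (hb i).choose_spec⟩
  zero_mem' := fun i => ⟨0, HasWeakDeriv.zero i⟩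
  smul_mem' := fun c _ ha i => ⟨_, (ha i).choose_spec.smul c⟩

theorem hasWeakDeriv_weakDeriv {D : Opens (E d)} {u : L2 D} (hu : u ∈ H1 D) (i : Fin d) :
    HasWeakDeriv i u (weakDeriv i u) := by
  obtain ⟨g, hg⟩ := hu i
  rw [hg.weakDeriv_eq]
  exact hg

/-- The norm of `H¹(D)`. -/
def normH1 {D : Opens (E d)} (u : L2 D) : ℝ :=
  Real.sqrt (‖u‖ ^ 2 + ∑ i, ‖weakDeriv i u‖ ^ 2)

/-- The Sobolev space `H²(D)`. -/
def H2 (D : Opens (E d)) : Set (L2 D) :=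
  {u | u ∈ H1 D ∧ ∀ i : Fin d, weakDeriv i u ∈ H1 D}

/-- The norm of `H²(D)`. -/
def normH2 {D : Opens (E d)} (u : L2 D) : ℝ :=
  Real.sqrt (‖u‖ ^ 2 + ∑ i, ‖weakDeriv i u‖ ^ 2
    + ∑ i, ∑ j, ‖weakDeriv j (weakDeriv i u)‖ ^ 2)

/-- `H¹₀(D)`, the closure of `C_c^∞(D)` in `H¹(D)`. -/
def H10 (D : Opens (E d)) : Set (L2 D) :=
  {u | u ∈ H1 D ∧ ∀ ε : ℝ, 0 < ε → ∃ (φ : E d → ℝ) (f : L2 D),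
    IsTest D φ ∧ f =ᵐ[volume.restrict (D : Set (E d))] φ ∧ normH1 (u - f) < ε}

/-- `H¹(D)^d`, as a subspace of `L²(D)^d`. -/
def H1Vec (D : Opens (E d)) : Submodule ℝ (L2Vec D) where
  carrier := {v | ∀ i : Fin d, v i ∈ H1 D}
  add_mem' := fun ha hb i => (H1 D).add_mem (ha i) (hb i)
  zero_mem' := fun _ => (H1 D).zero_mem
  smul_mem' := fun c _ ha i => (H1 D).smul_mem c (ha i)

/-- The norm of `H¹(D)^d`. -/
def normH1Vec {D : Opens (E d)} (v : L2Vec D) : ℝ :=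
  Real.sqrt (∑ i, normH1 (v i) ^ 2)

/-- The divergence `∇ · v` of `v ∈ H¹(D)^d`. -/
def div {D : Opens (E d)} (v : L2Vec D) : L2 D :=
  ∑ i, weakDeriv i (v i)

theorem div_add {D : Opens (E d)} {v w : L2Vec D} (hv : v ∈ H1Vec D) (hw : w ∈ H1Vec D) :
    div (v + w) = div v + div w := by
  rw [div, div, div, ← Finset.sum_add_distrib]
  refine Finset.sum_congr rfl fun i _ => ?_
  exact ((hasWeakDeriv_weakDeriv (hv i) i).add (hasWeakDeriv_weakDeriv (hw i) i)).weakDeriv_eq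

theorem div_smul {D : Opens (E d)} {v : L2Vec D} (c : ℝ) (hv : v ∈ H1Vec D) :
    div (c • v) = c • div v := by
  rw [div, div, Finset.smul_sum]
  refine Finset.sum_congr rfl fun i _ => ?_
  exact ((hasWeakDeriv_weakDeriv (hv i) i).smul c).weakDeriv_eq

theorem div_zero {D : Opens (E d)} : div (0 : L2Vec D) = 0 := by
  have h := div_smul (D := D) (v := 0) 0 (H1Vec D).zero_mem
  rwa [zero_smul, zero_smul] at h

/-- Elliptic `H²` regularity of the homogeneous Dirichlet problem in `D`: for every `f ∈ L²(D)`,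
the weak solution `q ∈ H¹₀(D)` of `Δ q = f` lies in `H²(D)`, and `‖q‖_{H²} ≤ C ‖f‖_{L²}`
with `C` independent of `f`. -/
def DirichletH2Regular (D : Opens (E d)) : Prop :=
  ∃ C : ℝ, ∀ f : L2 D, ∀ q ∈ H10 D,
    (∀ η ∈ H10 D, ∑ i, ⟪weakDeriv i q, weakDeriv i η⟫_ℝ = - ⟪f, η⟫_ℝ) →
      q ∈ H2 D ∧ normH2 q ≤ C * ‖f‖

/-- The pair `V_h × Q_h ⊂ H¹(D)^d × L²(D)` has the standard
properties of an inf-sup stable mixed finite element pair with mesh size `h`, where `K` is an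
admissible constant in all the estimates. -/
structure IsMixedPair (D : Opens (E d)) (K h : ℝ)
    (V : Submodule ℝ (L2Vec D)) (Q : Submodule ℝ (L2 D)) : Prop where
  V_le : V ≤ H1Vec D
  /-- Fortin operator. -/
  fortin : ∃ F : H1Vec D →ₗ[ℝ] L2Vec D,
    (∀ v : H1Vec D, F v ∈ V) ∧
    (∀ v : H1Vec D, ∀ q ∈ Q, ⟪div ((v : L2Vec D) - F v), q⟫_ℝ = 0) ∧
    (∀ v : H1Vec D, ‖(v : L2Vec D) - F v‖ ≤ K * h * normH1Vec (v : L2Vec D)) ∧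
    (∀ v : H1Vec D, normH1Vec ((v : L2Vec D) - F v) ≤ K * normH1Vec (v : L2Vec D)) ∧
    (∀ v : H1Vec D, normH1Vec (F v) ≤ K * normH1Vec (v : L2Vec D))
  /-- Approximation properties of `Q_h`. -/
  approx_one : ∀ q ∈ H1 D, Metric.infDist q (Q : Set (L2 D)) ≤ K * h * normH1 q
  approx_two : ∀ q ∈ H2 D, Metric.infDist q (Q : Set (L2 D)) ≤ K * h ^ 2 * normH2 q
  /-- Approximation properties of `Q_h ∩ H¹₀(D)`. -/
  approx_zero_one : ∀ q ∈ H10 D,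
    Metric.infDist q ((Q : Set (L2 D)) ∩ H10 D) ≤ K * h * normH1 q
  approx_zero_two : ∀ q ∈ H2 D ∩ H10 D,
    Metric.infDist q ((Q : Set (L2 D)) ∩ H10 D) ≤ K * h ^ 2 * normH2 q
  /-- Inverse inequality. -/
  inverse : ∀ v ∈ V, normH1Vec v ≤ K * h⁻¹ * ‖v‖
  /-- Inf-sup condition. -/
  inf_sup : ∀ q ∈ Q, ‖q‖ ≤ K * sSup {r : ℝ | ∃ v ∈ V, v ≠ 0 ∧ r = ⟪q, div v⟫_ℝ / normH1Vec v}

/-- The discretely divergence-free subspace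
`X_h = {v_h ∈ V_h : (∇ · v_h, q_h) = 0 for all q_h ∈ Q_h}` of a space `V_h ⊂ H¹(D)^d`. -/
def Xh {D : Opens (E d)} (V : Submodule ℝ (L2Vec D)) (Q : Submodule ℝ (L2 D)) :
    Submodule ℝ (L2Vec D) where
  carrier := {v | v ∈ V ∧ v ∈ H1Vec D ∧ ∀ q ∈ Q, ⟪div v, q⟫_ℝ = 0}
  add_mem' := fun {a b} ha hb => ⟨V.add_mem ha.1 hb.1, (H1Vec D).add_mem ha.2.1 hb.2.1,
    fun q hq => by rw [div_add ha.2.1 hb.2.1, inner_add_left, ha.2.2 q hq, hb.2.2 q hq, add_zero]⟩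
  zero_mem' := ⟨V.zero_mem, (H1Vec D).zero_mem, fun q _ => by rw [div_zero, inner_zero_left]⟩
  smul_mem' := fun c {a} ha => ⟨V.smul_mem c ha.1, (H1Vec D).smul_mem c ha.2.1,
    fun q hq => by rw [div_smul c ha.2.1, inner_smul_left, ha.2.2 q hq, mul_zero]⟩

theorem Xh_le {D : Opens (E d)} (V : Submodule ℝ (L2Vec D)) (Q : Submodule ℝ (L2 D)) :
    Xh V Q ≤ V := fun _ hv => hv.1

/-- The `L²`-orthogonal complement `X_h^⊥` of `X_h` in `V_h`. -/
def XhPerp {D : Opens (E d)} (V : Submodule ℝ (L2Vec D)) (Q : Submodule ℝ (L2 D)) :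
    Submodule ℝ (L2Vec D) :=
  V ⊓ (Xh V Q)ᗮ

instance {D : Opens (E d)} (V : Submodule ℝ (L2Vec D)) (Q : Submodule ℝ (L2 D))
    [FiniteDimensional ℝ V] : FiniteDimensional ℝ (Xh V Q) :=
  Submodule.finiteDimensional_of_le (Xh_le V Q)

/-- The `L²`-orthogonal projection `P_{X_h} : L²(D)^d → X_h` (with values regarded
in `L²(D)^d`). -/
def projXh {D : Opens (E d)} (V : Submodule ℝ (L2Vec D)) (Q : Submodule ℝ (L2 D))
    [FiniteDimensional ℝ V] : L2Vec D →L[ℝ] L2Vec D :=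
  (Xh V Q).starProjection

end StokesFEM

end

open StokesFEM

namespace StokesFEM

variable {d : ℕ} {D : Opens (E d)}

/-! The core is the `H¹` stability of `P_{X_h}`. Solve the Dirichlet problem `Δq = ∇·v` and write `v
= u + ∇q` with `∇·u = 0`; elliptic regularity bounds `‖q‖_{H²}`, hence also `‖u‖_{H¹}`, by
`‖v‖_{H¹}`.

For `u`, the Fortin image lies in `X_h`, so `P u = Πu + P(u - Πu)`. The second term is `O(h)` in
`L²`, and the inverse inequality gives back one power of `h` (`normH1Vec_projXh_le_of_div_eq_zero`).
For `g = P ∇q`, integration by parts gives `‖g‖² = -(q, ∇·g)`. As `∇·g ⊥ Q_h`, only the distance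
from `q` to `Q_h` counts, which is `O(h²)`; two inverse inequalities absorb it
(`normH1Vec_projXh_grad_le`).

Existence of `q` comes from Lax–Milgram on `H¹₀`, realized as the closure of the gradient graph over
test functions, with coercivity from Friedrichs' inequality. The decomposition then follows from `w
= P v` and `z = v - P v`. -/

/-! ### Test functions and Friedrichs' inequality. -/

theorem inner_toLp (u : L2 D) {f : E d → ℝ}
    (hf : MemLp f 2 (volume.restrict (D : Set (E d)))) :
    ⟪u, hf.toLp f⟫_ℝ = ∫ x in (D : Set (E d)), u x * f x := by
  rw [L2.inner_def]
  refine integral_congr_ae ?_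
  filter_upwards [hf.coeFn_toLp] with x hx
  rw [hx]
  simp [mul_comm]

/-- In this form each test function imposes a condition continuous in `(u, g)`, so weak derivatives
pass to `L²` limits. -/
theorem hasWeakDeriv_iff_inner {i : Fin d} {u g : L2 D} :
    HasWeakDeriv i u g ↔ ∀ (φ : E d → ℝ) (hφ : IsTest D φ),
      ⟪u, (hφ.memLp_partialDeriv i).toLp⟫_ℝ = -⟪g, hφ.memLp.toLp⟫_ℝ := by
  unfold HasWeakDeriv
  simp only [inner_toLp]

/-- An `L²` function orthogonal to all test functions vanishes. -/
theorem eq_zero_of_inner_test {g : L2 D}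
    (h : ∀ (φ : E d → ℝ) (hφ : IsTest D φ), ⟪g, hφ.memLp.toLp⟫_ℝ = 0) : g = 0 := by
  rw [Lp.eq_zero_iff_ae_eq_zero]
  have hloc : LocallyIntegrableOn g (D : Set (E d)) volume :=
    locallyIntegrableOn_of_locallyIntegrable_restrict
      ((Lp.memLp g).locallyIntegrable (by norm_num))
  refine (ae_restrict_iff' D.isOpen.measurableSet).2
    (D.isOpen.ae_eq_zero_of_integral_contDiff_smul_eq_zero hloc fun φ hs hc ht => ?_)
  rw [← h φ ⟨hs, hc, ht⟩, inner_toLp,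
    ← setIntegral_eq_integral_of_forall_compl_eq_zero (s := (D : Set (E d)))]
  · simp only [smul_eq_mul, mul_comm]
  · intro x hx
    rw [image_eq_zero_of_notMem_tsupport fun hx' => hx (ht hx'), zero_smul]

theorem IsTest.differentiable {φ : E d → ℝ} (h : IsTest D φ) : Differentiable ℝ φ :=
  h.smooth.differentiable (by simp)

theorem IsTest.eq_zero {φ : E d → ℝ} (h : IsTest D φ) {x : E d} (hx : x ∉ D) : φ x = 0 :=
  image_eq_zero_of_notMem_tsupport fun hx' => hx (h.support hx')

theorem IsTest.add {φ ψ : E d → ℝ} (hφ : IsTest D φ) (hψ : IsTest D ψ) : IsTest D (φ + ψ) :=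
  ⟨hφ.smooth.add hψ.smooth, hφ.compact.add hψ.compact,
    (tsupport_add φ ψ).trans (Set.union_subset hφ.support hψ.support)⟩

theorem IsTest.smul {φ : E d → ℝ} (c : ℝ) (hφ : IsTest D φ) : IsTest D (c • φ) :=
  ⟨contDiff_const.smul hφ.smooth, hφ.compact.smul_left (f := fun _ => c),
    (tsupport_smul_subset_right (fun _ => c) φ).trans hφ.support⟩

theorem IsTest.zero : IsTest D (0 : E d → ℝ) :=
  ⟨contDiff_const, HasCompactSupport.zero, by simp⟩

theorem IsTest.continuous_partialDeriv {φ : E d → ℝ} (h : IsTest D φ) (i : Fin d) :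
    Continuous (partialDeriv i φ) :=
  (h.smooth.continuous_fderiv (by simp)).clm_apply continuous_const

theorem IsTest.hasCompactSupport_partialDeriv {φ : E d → ℝ} (h : IsTest D φ) (i : Fin d) :
    HasCompactSupport (partialDeriv i φ) :=
  h.compact.fderiv_apply (𝕜 := ℝ) _

/-- The classical partial derivatives of a test function are its weak derivatives. -/
theorem IsTest.hasWeakDeriv {φ : E d → ℝ} (h : IsTest D φ) (i : Fin d) :
    HasWeakDeriv i (h.memLp.toLp φ : L2 D) ((h.memLp_partialDeriv i).toLp) := by
  intro ψ hψ
  have e₁ : ∫ x in (D : Set (E d)), (h.memLp.toLp φ : L2 D) x * partialDeriv i ψ x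
      = ∫ x, φ x * fderiv ℝ ψ x (EuclideanSpace.single i 1) := by
    rw [← setIntegral_eq_integral_of_forall_compl_eq_zero (s := (D : Set (E d)))
      (f := fun x => φ x * fderiv ℝ ψ x (EuclideanSpace.single i 1))
      fun x hx => by rw [h.eq_zero hx, zero_mul]]
    refine integral_congr_ae ?_
    filter_upwards [h.memLp.coeFn_toLp] with x hx
    rw [hx, partialDeriv]
  have e₂ : ∫ x in (D : Set (E d)),
        ((h.memLp_partialDeriv i).toLp (partialDeriv i φ) : L2 D) x * ψ x
      = ∫ x, fderiv ℝ φ x (EuclideanSpace.single i 1) * ψ x := by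
    rw [← setIntegral_eq_integral_of_forall_compl_eq_zero (s := (D : Set (E d)))
      (f := fun x => fderiv ℝ φ x (EuclideanSpace.single i 1) * ψ x)
      fun x hx => by rw [hψ.eq_zero hx, mul_zero]]
    refine integral_congr_ae ?_
    filter_upwards [(h.memLp_partialDeriv i).coeFn_toLp] with x hx
    rw [hx, partialDeriv]
  rw [e₁, e₂]
  refine integral_mul_fderiv_eq_neg_fderiv_mul_of_integrable ?_ ?_ ?_
    (fun x _ => h.differentiable x) (fun x _ => hψ.differentiable x)
  · exact ((h.continuous_partialDeriv i).mul hψ.smooth.continuous).integrable_of_hasCompactSupport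
      hψ.compact.mul_left
  · exact (h.smooth.continuous.mul (hψ.continuous_partialDeriv i)).integrable_of_hasCompactSupport
      h.compact.mul_right
  · exact (h.smooth.continuous.mul hψ.smooth.continuous).integrable_of_hasCompactSupport
      h.compact.mul_right

/-- Friedrichs' inequality for a test function. -/
theorem IsTest.friedrichs {R : ℝ} (hR : ∀ x ∈ D, ‖x‖ ≤ R) {φ : E d → ℝ} (h : IsTest D φ)
    (i : Fin d) : ‖(h.memLp.toLp φ : L2 D)‖
      ≤ 2 * R * ‖((h.memLp_partialDeriv i).toLp (partialDeriv i φ) : L2 D)‖ := by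
  set u : L2 D := h.memLp.toLp φ
  set g : L2 D := (h.memLp_partialDeriv i).toLp (partialDeriv i φ)
  have hcoord : ∀ x : E d, HasFDerivAt (fun y : E d => y i) (EuclideanSpace.proj i : E d →L[ℝ] ℝ) x :=
    fun x => (EuclideanSpace.proj i : E d →L[ℝ] ℝ).hasFDerivAt
  -- the test function `x_i φ`
  have hψ : IsTest D (fun x => x i * φ x) :=
    ⟨(EuclideanSpace.proj i : E d →L[ℝ] ℝ).contDiff.mul h.smooth, h.compact.mul_left,
      (tsupport_mul_subset_right).trans h.support⟩
  have hd : ∀ x, partialDeriv i (fun x => x i * φ x) x = φ x + x i * partialDeriv i φ x := by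
    intro x
    rw [partialDeriv, HasFDerivAt.fderiv (f := fun x : E d => x i * φ x)
      ((hcoord x).mul (h.differentiable x).hasFDerivAt)]
    simp [partialDeriv]
    ring
  have hu : (u : E d → ℝ) =ᵐ[volume.restrict (D : Set (E d))] φ := h.memLp.coeFn_toLp
  have hg : (g : E d → ℝ) =ᵐ[volume.restrict (D : Set (E d))] partialDeriv i φ :=
    (h.memLp_partialDeriv i).coeFn_toLp
  have hm : MemLp (fun x => x i * partialDeriv i φ x) 2 (volume.restrict (D : Set (E d))) := by
    refine Continuous.memLp_of_hasCompactSupport ?_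
      (h.hasCompactSupport_partialDeriv i).mul_left
    exact (EuclideanSpace.proj i : E d →L[ℝ] ℝ).continuous.mul (h.continuous_partialDeriv i)
  set m : L2 D := hm.toLp
  have hmn : ‖m‖ ≤ R * ‖g‖ := by
    refine Lp.norm_le_mul_norm_of_ae_le_mul ?_
    filter_upwards [hm.coeFn_toLp, hg, ae_restrict_mem D.isOpen.measurableSet] with x h₁ h₂ hx
    rw [h₁, h₂, norm_mul]
    exact mul_le_mul_of_nonneg_right ((PiLp.norm_apply_le x i).trans (hR x hx)) (norm_nonneg _)
  -- Testing with `x_i φ` gives `‖u‖² + (u, m) = -(u, m)` for `m = x_i ∂_i φ`, so `‖u‖² = -2 (u,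
  -- m)`.
  have key := (hasWeakDeriv_iff_inner.1 (h.hasWeakDeriv i)) _ hψ
  have e₁ : ((hψ.memLp_partialDeriv i).toLp : L2 D) = u + m := by
    rw [← MemLp.toLp_add]
    exact MemLp.toLp_congr _ _ (ae_of_all _ hd)
  have e₂ : ⟪g, (hψ.memLp.toLp : L2 D)⟫_ℝ = ⟪u, m⟫_ℝ := by
    rw [inner_toLp, inner_toLp]
    refine integral_congr_ae ?_
    filter_upwards [hu, hg] with x h₁ h₂
    rw [h₁, h₂]
    ring
  rw [e₁, inner_add_right, e₂, real_inner_self_eq_norm_sq] at key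
  have hcs := abs_le.1 (abs_real_inner_le_norm u m)
  have hle : ‖u‖ * ‖u‖ ≤ (2 * R * ‖g‖) * ‖u‖ := by
    nlinarith [norm_nonneg u, mul_le_mul_of_nonneg_left hmn (norm_nonneg u)]
  rcases (norm_nonneg u).eq_or_lt with h0 | h0
  · rw [← h0]
    -- `R` has no assumed sign; `0 ≤ R * ‖g‖` comes from the bound on `‖m‖`.
    have := (norm_nonneg m).trans hmn
    linarith
  · exact le_of_mul_le_mul_right hle h0

/-! ### The graph of the gradient and `H¹₀` as a Hilbert space. -/

/-- The weak gradient. -/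
noncomputable def grad (u : L2 D) : L2Vec D := WithLp.toLp 2 fun i => weakDeriv i u

@[simp] theorem grad_apply (u : L2 D) (i : Fin d) : grad u i = weakDeriv i u := rfl

theorem weakDeriv_add {u v : L2 D} (hu : u ∈ H1 D) (hv : v ∈ H1 D) (i : Fin d) :
    weakDeriv i (u + v) = weakDeriv i u + weakDeriv i v :=
  ((hasWeakDeriv_weakDeriv hu i).add (hasWeakDeriv_weakDeriv hv i)).weakDeriv_eq

theorem weakDeriv_smul {u : L2 D} (c : ℝ) (hu : u ∈ H1 D) (i : Fin d) :
    weakDeriv i (c • u) = c • weakDeriv i u :=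
  ((hasWeakDeriv_weakDeriv hu i).smul c).weakDeriv_eq

theorem grad_add {u v : L2 D} (hu : u ∈ H1 D) (hv : v ∈ H1 D) :
    grad (u + v) = grad u + grad v := by
  ext1 i
  exact weakDeriv_add hu hv i

theorem grad_smul {u : L2 D} (c : ℝ) (hu : u ∈ H1 D) : grad (c • u) = c • grad u := by
  ext1 i
  exact weakDeriv_smul c hu i

theorem grad_sub {u v : L2 D} (hu : u ∈ H1 D) (hv : v ∈ H1 D) :
    grad (u - v) = grad u - grad v := by
  have := grad_add hu ((H1 D).smul_mem (-1) hv)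
  rw [grad_smul _ hv] at this
  simpa [sub_eq_add_neg] using this

theorem div_sub {v w : L2Vec D} (hv : v ∈ H1Vec D) (hw : w ∈ H1Vec D) :
    div (v - w) = div v - div w := by
  have := div_add hv ((H1Vec D).smul_mem (-1) hw)
  rw [div_smul _ hw] at this
  simpa [sub_eq_add_neg] using this

/-- The space `L²(D) × L²(D)^d` that contains the graph of the weak gradient. -/
abbrev GraphSpace (D : Opens (E d)) : Type := WithLp 2 (L2 D × L2Vec D)

/-- The point of the graph of the weak gradient over `u`. -/
noncomputable def jet (u : L2 D) : GraphSpace D := WithLp.toLp 2 (u, grad u)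

/-- Turns `H¹` approximation into convergence in a Hilbert space, where closures and completeness
are available. -/
theorem norm_jet (u : L2 D) : ‖jet u‖ = normH1 u := by
  rw [← Real.sqrt_sq (norm_nonneg (jet u)), WithLp.prod_norm_sq_eq_of_L2, normH1,
    PiLp.norm_sq_eq_of_L2]
  rfl

theorem jet_add {u v : L2 D} (hu : u ∈ H1 D) (hv : v ∈ H1 D) : jet (u + v) = jet u + jet v := by
  rw [jet, grad_add hu hv]
  rfl

theorem jet_smul {u : L2 D} (c : ℝ) (hu : u ∈ H1 D) : jet (c • u) = c • jet u := by
  rw [jet, grad_smul c hu]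
  rfl

theorem jet_sub {u v : L2 D} (hu : u ∈ H1 D) (hv : v ∈ H1 D) : jet (u - v) = jet u - jet v := by
  rw [jet, grad_sub hu hv]
  rfl

theorem IsTest.mem_H1 {φ : E d → ℝ} (h : IsTest D φ) : (h.memLp.toLp φ : L2 D) ∈ H1 D :=
  fun i => ⟨_, h.hasWeakDeriv i⟩

/-- The graph of the gradient over the test functions. -/
noncomputable def testGraph (D : Opens (E d)) : Submodule ℝ (GraphSpace D) where
  carrier := {p | ∃ (φ : E d → ℝ) (hφ : IsTest D φ), p = jet (hφ.memLp.toLp φ)}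
  add_mem' := by
    rintro _ _ ⟨φ, hφ, rfl⟩ ⟨ψ, hψ, rfl⟩
    refine ⟨φ + ψ, hφ.add hψ, ?_⟩
    rw [← jet_add hφ.mem_H1 hψ.mem_H1, ← MemLp.toLp_add]
  zero_mem' := by
    refine ⟨0, IsTest.zero, ?_⟩
    rw [MemLp.toLp_zero]
    simpa using (jet_smul (D := D) 0 (H1 D).zero_mem).symm
  smul_mem' := by
    rintro c _ ⟨φ, hφ, rfl⟩
    refine ⟨c • φ, hφ.smul c, ?_⟩
    rw [← jet_smul c hφ.mem_H1, ← MemLp.toLp_const_smul]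

theorem mem_closure_testGraph_of_mem_H10 {u : L2 D} (hu : u ∈ H10 D) :
    jet u ∈ (testGraph D).topologicalClosure := by
  rw [← SetLike.mem_coe, Submodule.topologicalClosure_coe, Metric.mem_closure_iff]
  intro ε hε
  obtain ⟨φ, f, hφ, hf, hlt⟩ := hu.2 ε hε
  have hf' : f = hφ.memLp.toLp φ := by
    rw [← Lp.toLp_coeFn f (Lp.memLp f)]
    exact MemLp.toLp_congr _ _ hf
  subst hf'
  refine ⟨_, ⟨φ, hφ, rfl⟩, ?_⟩
  rwa [dist_eq_norm, ← jet_sub hu.1 hφ.mem_H1, norm_jet]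

theorem isClosed_setOf_hasWeakDeriv (i : Fin d) :
    IsClosed {p : GraphSpace D | HasWeakDeriv i p.fst (p.snd i)} := by
  simp only [hasWeakDeriv_iff_inner, Set.ofPred_forall]
  refine isClosed_iInter fun φ => isClosed_iInter fun hφ => isClosed_eq ?_ ?_
  · exact ((WithLp.fstL 2 ℝ (L2 D) (L2Vec D)).continuous).inner continuous_const
  · exact (((PiLp.proj (𝕜 := ℝ) 2 (fun _ : Fin d => L2 D) i).continuous.comp
      (WithLp.sndL 2 ℝ (L2 D) (L2Vec D)).continuous).inner continuous_const).neg

theorem hasWeakDeriv_of_mem_closure_testGraph {p : GraphSpace D}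
    (hp : p ∈ (testGraph D).topologicalClosure) (i : Fin d) :
    HasWeakDeriv i p.fst (p.snd i) := by
  refine closure_minimal ?_ (isClosed_setOf_hasWeakDeriv i) hp
  rintro _ ⟨φ, hφ, rfl⟩
  exact hasWeakDeriv_weakDeriv hφ.mem_H1 i

/-- The weak gradient is a closed operator, so limits of graph points stay on its graph. -/
theorem eq_jet_of_mem_closure_testGraph {p : GraphSpace D}
    (hp : p ∈ (testGraph D).topologicalClosure) : p = jet p.fst := by
  have : p.snd = grad p.fst := by
    ext1 i
    exact (hasWeakDeriv_of_mem_closure_testGraph hp i).weakDeriv_eq.symm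
  rw [jet, ← this]
  rfl

theorem fst_mem_H10_of_mem_closure_testGraph {p : GraphSpace D}
    (hp : p ∈ (testGraph D).topologicalClosure) : p.fst ∈ H10 D := by
  have h1 : p.fst ∈ H1 D := fun i => ⟨_, hasWeakDeriv_of_mem_closure_testGraph hp i⟩
  refine ⟨h1, fun ε hε => ?_⟩
  obtain ⟨_, ⟨φ, hφ, rfl⟩, hlt⟩ := Metric.mem_closure_iff.1 hp ε hε
  refine ⟨φ, hφ.memLp.toLp φ, hφ, hφ.memLp.coeFn_toLp, ?_⟩
  rwa [eq_jet_of_mem_closure_testGraph hp, dist_eq_norm, ← jet_sub h1 hφ.mem_H1, norm_jet] at hlt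

/-- Friedrichs' inequality on the closure of the graph of the gradient over the test functions. -/
theorem norm_fst_le_of_mem_closure_testGraph (hd : 0 < d) {R : ℝ} (hR : ∀ x ∈ D, ‖x‖ ≤ R)
    (hR0 : 0 ≤ R) {p : GraphSpace D} (hp : p ∈ (testGraph D).topologicalClosure) :
    ‖p.fst‖ ≤ 2 * R * ‖p.snd‖ := by
  refine closure_minimal (t := {p : GraphSpace D | ‖p.fst‖ ≤ 2 * R * ‖p.snd‖}) ?_ ?_ hp
  · rintro _ ⟨φ, hφ, rfl⟩
    refine (hφ.friedrichs hR ⟨0, hd⟩).trans (mul_le_mul_of_nonneg_left ?_ (by positivity))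
    rw [← (hφ.hasWeakDeriv ⟨0, hd⟩).weakDeriv_eq]
    -- One coordinate direction suffices; `d ≥ 1` provides it.
    exact PiLp.norm_apply_le (grad (hφ.memLp.toLp φ : L2 D)) ⟨0, hd⟩
  · exact isClosed_le (WithLp.fstL 2 ℝ (L2 D) (L2Vec D)).continuous.norm
      (continuous_const.mul (WithLp.sndL 2 ℝ (L2 D) (L2Vec D)).continuous.norm)

/-! ### The Dirichlet problem: weak and strong solutions. -/

/-- The normal equation of an operator that is bounded below is solvable. -/
theorem exists_forall_inner_eq_of_bounded_below {M X : Type*}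
    [NormedAddCommGroup M] [InnerProductSpace ℝ M] [CompleteSpace M]
    [NormedAddCommGroup X] [InnerProductSpace ℝ X] (S : M →L[ℝ] X) {c : ℝ} (hc : 0 < c)
    (hS : ∀ p, c * ‖p‖ ^ 2 ≤ ‖S p‖ ^ 2) (l : M →L[ℝ] ℝ) :
    ∃ p, ∀ e, ⟪S p, S e⟫_ℝ = l e := by
  let B : M →L[ℝ] M →L[ℝ] ℝ := (innerSL ℝ).bilinearComp S S
  have hBS : ∀ p e, B p e = ⟪S p, S e⟫_ℝ := fun _ _ => by
    simp [B, ContinuousLinearMap.bilinearComp_apply]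
  have hB : IsCoercive B := by
    refine ⟨c, hc, fun p => ?_⟩
    rw [hBS, real_inner_self_eq_norm_sq, mul_assoc, ← sq]
    exact hS p
  refine ⟨hB.continuousLinearEquivOfBilin.symm ((InnerProductSpace.toDual ℝ M).symm l),
    fun e => ?_⟩
  rw [← hBS, ← hB.continuousLinearEquivOfBilin_apply, ContinuousLinearEquiv.apply_symm_apply,
    InnerProductSpace.toDual_symm_apply]

/-- Existence of weak solutions of the homogeneous Dirichlet problem in a bounded open set. -/
theorem exists_weak_solution (hd : 0 < d) (hbdd : Bornology.IsBounded (D : Set (E d)))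
    (f : L2 D) : ∃ q ∈ H10 D, ∀ η ∈ H10 D,
      ∑ i, ⟪weakDeriv i q, weakDeriv i η⟫_ℝ = -⟪f, η⟫_ℝ := by
  obtain ⟨R, hR0, hR⟩ := hbdd.exists_pos_norm_le
  have : CompleteSpace (testGraph D).topologicalClosure :=
    (Submodule.isClosed_topologicalClosure _).completeSpace_coe
  obtain ⟨p, hp⟩ := exists_forall_inner_eq_of_bounded_below (M := (testGraph D).topologicalClosure)
    ((WithLp.sndL 2 ℝ (L2 D) (L2Vec D)).comp (testGraph D).topologicalClosure.subtypeL)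
    -- Friedrichs gives `‖p‖² = ‖p.fst‖² + ‖p.snd‖² ≤ (1 + (2R)²) ‖p.snd‖²`.
    (c := (1 + (2 * R) ^ 2)⁻¹) (by positivity) (fun p => by
      have h₁ := norm_fst_le_of_mem_closure_testGraph hd hR hR0.le p.2
      have h₂ := WithLp.prod_norm_sq_eq_of_L2 (p : GraphSpace D)
      change _ * ‖(p : GraphSpace D)‖ ^ 2 ≤ ‖(p : GraphSpace D).snd‖ ^ 2
      rw [h₂, inv_mul_le_iff₀ (by positivity)]
      have h₃ := pow_le_pow_left₀ (norm_nonneg _) h₁ 2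
      rw [mul_pow] at h₃
      linarith)
    (-((innerSL ℝ f).comp
      ((WithLp.fstL 2 ℝ (L2 D) (L2Vec D)).comp (testGraph D).topologicalClosure.subtypeL)))
  refine ⟨(p : GraphSpace D).fst, fst_mem_H10_of_mem_closure_testGraph p.2, fun η hη => ?_⟩
  have h : ⟪(p : GraphSpace D).snd, grad η⟫_ℝ = -⟪f, η⟫_ℝ :=
    hp ⟨jet η, mem_closure_testGraph_of_mem_H10 hη⟩
  rw [← h, PiLp.inner_apply]
  refine Finset.sum_congr rfl fun i _ => ?_
  rw [(hasWeakDeriv_of_mem_closure_testGraph p.2 i).weakDeriv_eq, grad_apply]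

theorem IsTest.mem_H10 {φ : E d → ℝ} (h : IsTest D φ) : (h.memLp.toLp φ : L2 D) ∈ H10 D :=
  fst_mem_H10_of_mem_closure_testGraph
    ((testGraph D).le_topologicalClosure ⟨φ, h, rfl⟩ : jet (h.memLp.toLp φ : L2 D) ∈ _)

/-- Integration by parts without boundary term. -/
theorem inner_weakDeriv_of_mem_H10 {q x : L2 D} (hq : q ∈ H10 D) (hx : x ∈ H1 D) (i : Fin d) :
    ⟪weakDeriv i q, x⟫_ℝ = -⟪q, weakDeriv i x⟫_ℝ := by
  -- On test functions this is the definition of the weak derivative of `x`; both sides are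
  -- continuous in the graph norm.
  refine closure_minimal
    (t := {p : GraphSpace D | ⟪p.snd i, x⟫_ℝ = -⟪p.fst, weakDeriv i x⟫_ℝ}) ?_ ?_
    (mem_closure_testGraph_of_mem_H10 hq)
  · rintro _ ⟨φ, hφ, rfl⟩
    have h := hasWeakDeriv_iff_inner.1 (hasWeakDeriv_weakDeriv hx i) φ hφ
    rw [← (hφ.hasWeakDeriv i).weakDeriv_eq] at h
    rw [Set.mem_ofPred_eq, real_inner_comm, real_inner_comm (weakDeriv i x)]
    exact h
  · refine isClosed_eq ?_ ?_
    · exact (((PiLp.proj (𝕜 := ℝ) 2 (fun _ : Fin d => L2 D) i).continuous.comp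
        (WithLp.sndL 2 ℝ (L2 D) (L2Vec D)).continuous).inner continuous_const)
    · exact ((WithLp.fstL 2 ℝ (L2 D) (L2Vec D)).continuous.inner continuous_const).neg

theorem inner_grad_of_mem_H10 {q : L2 D} (hq : q ∈ H10 D) {x : L2Vec D} (hx : x ∈ H1Vec D) :
    ⟪grad q, x⟫_ℝ = -⟪q, div x⟫_ℝ := by
  rw [PiLp.inner_apply, div, inner_sum, ← Finset.sum_neg_distrib]
  exact Finset.sum_congr rfl fun i _ => inner_weakDeriv_of_mem_H10 hq (hx i) i

theorem grad_mem_H1Vec {q : L2 D} (hq : q ∈ H2 D) : grad q ∈ H1Vec D := hq.2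

/-- A weak solution in `H²` is a strong solution. -/
theorem div_grad_of_weak_solution {f q : L2 D} (hq : q ∈ H2 D)
    (h : ∀ η ∈ H10 D, ∑ i, ⟪weakDeriv i q, weakDeriv i η⟫_ℝ = -⟪f, η⟫_ℝ) :
    div (grad q) = f := by
  rw [← sub_eq_zero]
  refine eq_zero_of_inner_test fun φ hφ => ?_
  have h₁ := h _ hφ.mem_H10
  have h₂ := inner_grad_of_mem_H10 hφ.mem_H10 (grad_mem_H1Vec hq)
  rw [real_inner_comm, PiLp.inner_apply, real_inner_comm (div (grad q))] at h₂
  rw [inner_sub_left]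
  have h₃ := h₁.symm.trans h₂
  linarith

/-! ### Norm estimates for vector fields and the Helmholtz decomposition. -/

theorem normH1Vec_nonneg (v : L2Vec D) : 0 ≤ normH1Vec v := Real.sqrt_nonneg _

/-- The componentwise point of the graph of the weak gradient. -/
noncomputable def jetVec (v : L2Vec D) : PiLp 2 (fun _ : Fin d => GraphSpace D) :=
  WithLp.toLp 2 fun i => jet (v i)

theorem norm_jetVec (v : L2Vec D) : ‖jetVec v‖ = normH1Vec v := by
  rw [PiLp.norm_eq_of_L2, normH1Vec]
  simp only [jetVec, norm_jet]

theorem jetVec_add {v w : L2Vec D} (hv : v ∈ H1Vec D) (hw : w ∈ H1Vec D) :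
    jetVec (v + w) = jetVec v + jetVec w := by
  ext1 i
  exact jet_add (hv i) (hw i)

theorem jetVec_sub {v w : L2Vec D} (hv : v ∈ H1Vec D) (hw : w ∈ H1Vec D) :
    jetVec (v - w) = jetVec v - jetVec w := by
  ext1 i
  exact jet_sub (hv i) (hw i)

theorem normH1Vec_add_le {v w : L2Vec D} (hv : v ∈ H1Vec D) (hw : w ∈ H1Vec D) :
    normH1Vec (v + w) ≤ normH1Vec v + normH1Vec w := by
  rw [← norm_jetVec, jetVec_add hv hw, ← norm_jetVec, ← norm_jetVec]
  exact norm_add_le _ _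

theorem normH1Vec_sub_le {v w : L2Vec D} (hv : v ∈ H1Vec D) (hw : w ∈ H1Vec D) :
    normH1Vec (v - w) ≤ normH1Vec v + normH1Vec w := by
  rw [← norm_jetVec, jetVec_sub hv hw, ← norm_jetVec, ← norm_jetVec]
  exact norm_sub_le _ _

theorem norm_weakDeriv_le (u : L2 D) (i : Fin d) : ‖weakDeriv i u‖ ≤ normH1 u := by
  refine Real.le_sqrt_of_sq_le ?_
  have := Finset.single_le_sum (f := fun i => ‖weakDeriv i u‖ ^ 2)
    (fun j _ => sq_nonneg _) (Finset.mem_univ i)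
  nlinarith [sq_nonneg ‖u‖]

theorem norm_div_le (v : L2Vec D) : ‖div v‖ ≤ d * normH1Vec v := by
  have h : ∀ i ∈ Finset.univ, ‖weakDeriv i (v i)‖ ≤ normH1Vec v := fun i _ => by
    refine (norm_weakDeriv_le (v i) i).trans ?_
    rw [← norm_jet, ← norm_jetVec]
    exact PiLp.norm_apply_le (jetVec v) i
  rw [div]
  simpa using (norm_sum_le _ _).trans (Finset.sum_le_card_nsmul _ _ _ h)

theorem normH1Vec_grad_le (q : L2 D) : normH1Vec (grad q) ≤ normH2 q := by
  refine Real.sqrt_le_sqrt ?_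
  have : ∀ i, normH1 (grad q i) ^ 2
      = ‖weakDeriv i q‖ ^ 2 + ∑ j, ‖weakDeriv j (weakDeriv i q)‖ ^ 2 := fun i => by
    rw [normH1, Real.sq_sqrt (by positivity)]
    rfl
  simp only [this, Finset.sum_add_distrib]
  nlinarith [sq_nonneg ‖q‖]

/-- Orthogonality allows replacing `q` by `q - y` for any `y ∈ Q` before Cauchy–Schwarz; no
minimizer is needed. -/
theorem abs_inner_le_infDist_mul {H : Type*} [NormedAddCommGroup H] [InnerProductSpace ℝ H]
    (Q : Submodule ℝ H) (q : H) {x : H} (hx : ∀ y ∈ Q, ⟪x, y⟫_ℝ = 0) :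
    |⟪q, x⟫_ℝ| ≤ Metric.infDist q (Q : Set H) * ‖x‖ := by
  rcases (norm_nonneg x).eq_or_lt with h0 | h0
  · rw [norm_eq_zero.1 h0.symm]
    simp
  · rw [← div_le_iff₀ h0, Metric.le_infDist ⟨0, Q.zero_mem⟩]
    intro y hy
    rw [div_le_iff₀ h0, dist_eq_norm, ← sub_zero ⟪q, x⟫_ℝ, ← hx y hy, real_inner_comm y x,
      ← inner_sub_left]
    exact abs_real_inner_le_norm _ _

/-- Regular Helmholtz decomposition of `H¹` vector fields. -/
theorem DirichletH2Regular.exists_helmholtz (hd : 0 < d)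
    (hbdd : Bornology.IsBounded (D : Set (E d))) (hreg : DirichletH2Regular D) :
    ∃ A : ℝ, 0 ≤ A ∧ ∀ v ∈ H1Vec D, ∃ q ∈ H2 D ∩ H10 D,
      div (v - grad q) = 0 ∧ normH2 q ≤ A * normH1Vec v := by
  obtain ⟨C, hC⟩ := hreg
  -- The regularity constant has no assumed sign, hence `|C|`; the factor `d` bounds the divergence.
  refine ⟨|C| * d, by positivity, fun v hv => ?_⟩
  obtain ⟨q, hq0, hq⟩ := exists_weak_solution hd hbdd (div v)
  obtain ⟨hq2, hle⟩ := hC _ q hq0 hq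
  refine ⟨q, ⟨hq2, hq0⟩, ?_, ?_⟩
  · rw [div_sub hv (grad_mem_H1Vec hq2), div_grad_of_weak_solution hq2 hq, sub_self]
  · calc normH2 q ≤ C * ‖div v‖ := hle
      _ ≤ |C| * (d * normH1Vec v) := mul_le_mul (le_abs_self C) (norm_div_le v)
          (norm_nonneg _) (abs_nonneg C)
      _ = _ := by ring

/-! ### The projection onto `X_h` for one mixed pair. -/

section MixedPair

variable {K h : ℝ} {V : Submodule ℝ (L2Vec D)} {Q : Submodule ℝ (L2 D)} [FiniteDimensional ℝ V]

theorem projXh_mem (v : L2Vec D) : projXh V Q v ∈ Xh V Q :=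
  (Xh V Q).starProjection_apply_mem v

theorem projXh_eq_self {v : L2Vec D} (hv : v ∈ Xh V Q) : projXh V Q v = v :=
  Submodule.starProjection_eq_self_iff.2 hv

/-- The projection onto `X_h` is `H¹` stable on divergence-free fields. -/
theorem IsMixedPair.normH1Vec_projXh_le_of_div_eq_zero (hp : IsMixedPair D K h V Q) (hK : 0 < K)
    (hh : 0 < h) {u : L2Vec D} (hu : u ∈ H1Vec D) (hdiv : div u = 0) :
    normH1Vec (projXh V Q u) ≤ (K + K ^ 2) * normH1Vec u := by
  obtain ⟨F, hFV, hFdiv, hFL2, -, hFH1⟩ := hp.fortin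
  lift u to H1Vec D using hu
  have hF1 : F u ∈ H1Vec D := hp.V_le (hFV u)
  -- Since `∇·u = 0`, the Fortin identity makes `∇·(F u)` itself orthogonal to `Q`.
  have hFX : F u ∈ Xh V Q := ⟨hFV u, hF1, fun q hq => by
    have := hFdiv u q hq
    rwa [div_sub u.2 hF1, hdiv, zero_sub, inner_neg_left, neg_eq_zero] at this⟩
  have hPX : projXh V Q ((u : L2Vec D) - F u) ∈ Xh V Q := projXh_mem _
  have e : projXh V Q (u : L2Vec D) = F u + projXh V Q ((u : L2Vec D) - F u) := by
    rw [map_sub, projXh_eq_self hFX]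
    abel
  have hn : ‖projXh V Q ((u : L2Vec D) - F u)‖ ≤ K * h * normH1Vec (u : L2Vec D) :=
    ((Xh V Q).norm_starProjection_apply_le _).trans (hFL2 u)
  calc normH1Vec (projXh V Q (u : L2Vec D))
      ≤ normH1Vec (F u) + normH1Vec (projXh V Q ((u : L2Vec D) - F u)) := by
        rw [e]
        exact normH1Vec_add_le hF1 hPX.2.1
    -- The `h⁻¹` of the inverse inequality cancels the `h` of the Fortin error.
    _ ≤ K * normH1Vec (u : L2Vec D) + K * h⁻¹ * (K * h * normH1Vec (u : L2Vec D)) :=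
        add_le_add (hFH1 u) ((hp.inverse _ hPX.1).trans
          (mul_le_mul_of_nonneg_left hn (by positivity)))
    _ = _ := by
        field_simp

/-- The projection onto `X_h` of the gradient of a function in `H² ∩ H¹₀`. -/
theorem IsMixedPair.normH1Vec_projXh_grad_le (hp : IsMixedPair D K h V Q) (hK : 0 < K)
    (hh : 0 < h) {q : L2 D} (hq : q ∈ H2 D ∩ H10 D) :
    normH1Vec (projXh V Q (grad q)) ≤ K ^ 3 * d * normH2 q := by
  set g := projXh V Q (grad q) with hg
  have hgX : g ∈ Xh V Q := projXh_mem _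
  have hinv := hp.inverse g hgX.1
  have h0 : 0 ≤ normH2 q := Real.sqrt_nonneg _
  -- The second-order approximation is essential: one `h` is spent on `∇·g` here, the other on
  -- passing from `L²` to `H¹` at the end.
  have hsq : ‖g‖ * ‖g‖ ≤ (K * h ^ 2 * normH2 q * (d * (K * h⁻¹))) * ‖g‖ := by
    calc ‖g‖ * ‖g‖ = ⟪grad q, g⟫_ℝ := by
          rw [← real_inner_self_eq_norm_mul_norm, ← sub_eq_zero, ← inner_sub_left,
            ← neg_eq_zero, ← inner_neg_left, neg_sub]
          exact Submodule.starProjection_inner_eq_zero (grad q) g hgX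
      _ = -⟪q, div g⟫_ℝ := inner_grad_of_mem_H10 hq.2 hgX.2.1
      _ ≤ |⟪q, div g⟫_ℝ| := neg_le_abs _
      _ ≤ Metric.infDist q (Q : Set (L2 D)) * ‖div g‖ := abs_inner_le_infDist_mul Q q hgX.2.2
      _ ≤ (K * h ^ 2 * normH2 q) * (d * (K * h⁻¹ * ‖g‖)) :=
          mul_le_mul (hp.approx_two q hq.1)
            ((norm_div_le g).trans (mul_le_mul_of_nonneg_left hinv (by positivity)))
            (norm_nonneg _) (by positivity)
      _ = _ := by ring
  have hle : ‖g‖ ≤ K * h ^ 2 * normH2 q * (d * (K * h⁻¹)) := by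
    rcases (norm_nonneg g).eq_or_lt with hz | hz
    · rw [← hz]
      positivity
    · exact le_of_mul_le_mul_right hsq hz
  calc normH1Vec g ≤ K * h⁻¹ * (K * h ^ 2 * normH2 q * (d * (K * h⁻¹))) :=
        hinv.trans (mul_le_mul_of_nonneg_left hle (by positivity))
    _ = _ := by field_simp

/-- Forces the `X_h` part of any decomposition, giving uniqueness and reducing its stability to that
of the projection. -/
theorem projXh_add {w z : L2Vec D} (hw : w ∈ Xh V Q) (hz : z ∈ XhPerp V Q) :
    projXh V Q (w + z) = w := by
  rw [map_add, projXh_eq_self hw, show projXh V Q z = 0 from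
    ((Xh V Q).starProjection_apply_eq_zero_iff).2 hz.2, add_zero]

theorem existsUnique_Xh_add_XhPerp {v : L2Vec D} (hv : v ∈ V) :
    ∃! p : L2Vec D × L2Vec D, p.1 ∈ Xh V Q ∧ p.2 ∈ XhPerp V Q ∧ v = p.1 + p.2 := by
  refine ⟨(projXh V Q v, v - projXh V Q v), ⟨projXh_mem v,
    ⟨V.sub_mem hv (projXh_mem v).1, Submodule.sub_starProjection_mem_orthogonal v⟩,
    (add_sub_cancel _ _).symm⟩, ?_⟩
  rintro ⟨w, z⟩ ⟨hw, hz, rfl⟩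
  simp [projXh_add hw hz]

end MixedPair

/-! ### Uniform stability and the final decomposition. -/

/-- `H¹` stability of the projection onto `X_h`, uniformly in the mixed pair. -/
theorem DirichletH2Regular.exists_normH1Vec_projXh_le (hd : 0 < d)
    (hbdd : Bornology.IsBounded (D : Set (E d))) (hreg : DirichletH2Regular D) {K : ℝ}
    (hK : 0 < K) :
    ∃ C : ℝ, 0 ≤ C ∧ ∀ h : ℝ, 0 < h → ∀ (V : Submodule ℝ (L2Vec D)) (Q : Submodule ℝ (L2 D))
      [FiniteDimensional ℝ V], IsMixedPair D K h V Q →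
        ∀ v ∈ H1Vec D, normH1Vec (projXh V Q v) ≤ C * normH1Vec v := by
  obtain ⟨A, hA, hH⟩ := hreg.exists_helmholtz hd hbdd
  refine ⟨(K + K ^ 2) * (1 + A) + K ^ 3 * d * A, by positivity, fun h hh V Q _ hp v hv => ?_⟩
  obtain ⟨q, hq, hdiv, hle⟩ := hH v hv
  have hgrad := grad_mem_H1Vec hq.1
  have hu : normH1Vec (v - grad q) ≤ (1 + A) * normH1Vec v := by
    linarith [normH1Vec_sub_le hv hgrad, normH1Vec_grad_le q]
  calc normH1Vec (projXh V Q v)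
      = normH1Vec (projXh V Q (v - grad q) + projXh V Q (grad q)) := by
        rw [← map_add, sub_add_cancel]
    _ ≤ normH1Vec (projXh V Q (v - grad q)) + normH1Vec (projXh V Q (grad q)) :=
        normH1Vec_add_le (projXh_mem _).2.1 (projXh_mem _).2.1
    _ ≤ (K + K ^ 2) * ((1 + A) * normH1Vec v) + K ^ 3 * d * (A * normH1Vec v) :=
        add_le_add
          ((hp.normH1Vec_projXh_le_of_div_eq_zero hK hh ((H1Vec D).sub_mem hv hgrad) hdiv).trans
            (mul_le_mul_of_nonneg_left hu (by positivity)))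
          ((hp.normH1Vec_projXh_grad_le hK hh hq).trans
            (mul_le_mul_of_nonneg_left hle (by positivity)))
    _ = _ := by ring

end StokesFEM

theorem lemma4p2 {d : ℕ} (hd : 0 < d) (D : Opens (E d))
    (hbdd : Bornology.IsBounded (D : Set (E d))) (hreg : DirichletH2Regular D)
    (K : ℝ) (hK : 0 < K) :
    ∃ C : ℝ, 0 < C ∧
      ∀ (h : ℝ), 0 < h →
      ∀ (V : Submodule ℝ (L2Vec D)) (Q : Submodule ℝ (L2 D))
        [FiniteDimensional ℝ V] [FiniteDimensional ℝ Q],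
        IsMixedPair D K h V Q →
          -- the orthogonal decomposition of `V`
          (∀ v ∈ V, ∃! p : L2Vec D × L2Vec D,
            p.1 ∈ Xh V Q ∧ p.2 ∈ XhPerp V Q ∧ v = p.1 + p.2) ∧
          -- its stability in the `H¹` norm
          (∀ v ∈ V, ∀ w ∈ Xh V Q, ∀ z ∈ XhPerp V Q, v = w + z →
            normH1Vec w + normH1Vec z ≤ C * normH1Vec v) ∧
          -- the stability of the projection in the `H¹` norm
          (∀ v ∈ H1Vec D, projXh V Q v ∈ H1Vec D ∧
            normH1Vec (projXh V Q v) ≤ C * normH1Vec v) := by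
  obtain ⟨C, hC, hP⟩ := hreg.exists_normH1Vec_projXh_le hd hbdd hK
  -- `w` costs `C`, and `z = v - w` costs `1 + C`.
  refine ⟨1 + 2 * C, by positivity, fun h hh V Q _ _ hp =>
    ⟨fun v hv => existsUnique_Xh_add_XhPerp hv, fun v hv w hw z hz hvwz => ?_,
      fun v hv => ⟨(projXh_mem v).2.1, ?_⟩⟩⟩
  · have hw' : w = projXh V Q v := by rw [hvwz, projXh_add hw hz]
    have hv1 := hp.V_le hv
    have hle : normH1Vec w ≤ C * normH1Vec v := hw' ▸ hP h hh V Q hp v hv1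
    have hz' : normH1Vec z ≤ normH1Vec v + normH1Vec w := by
      rw [show z = v - w by rw [hvwz, add_sub_cancel_left]]
      exact normH1Vec_sub_le hv1 hw.2.1
    linarith
  · refine (hP h hh V Q hp v hv).trans
      (mul_le_mul_of_nonneg_right (by linarith) (normH1Vec_nonneg v))
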